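/- Let $E=\{0,\dots,n-1\}$, let $(A_i)_{i\in E}$ be real $d\times d$ matrices, and let $Q$ be an irreducible generator on $E$ (off-diagonal entries $\ge 0$, row sums $0$, every state reachable from every state through jumps of positive rate). Let $\pi$ be the invariant probability vector of $Q$, i.e. $\pi Q=0$, and put $\bar A=\sum_{i\in E}\pi_iA_i$. Assume that $\bar A$ is Hurwitz, i.e. all its eigenvalues have strictly negative real part. Then there is a constant $b>0$, depending only on $Q$ and $(A_i)_{i\in E}$, such that for every switching rate $r>b$ the following holds. Let $(I_t)_{t\ge0}$ be a right-continuous Markov process on $E$ with generator $rQ$ with respect to some filtration $(\mathcal F_t)_{t\ge 0}$ on a probability space, i.e. $I$ is adapted and $\mathbb P(I_t=j\mid\mathcal F_s)=\big(e^{(t-s)rQ}\big)_{I_s,j}$ almost surely for all $0\le s\le t$ and $j\in E$. Let $X_0$ be an $\mathcal F_0$-measurable random vector in $\mathbb R^d$ with $\mathbb E\|X_0\|<\infty$ (it may depend on $I_0$), and let $(X_t)_{t\ge0}$ be the solution of $$X_t=X_0+\int_0^tA_{I_s}X_s\,ds,\qquad t\ge0.$$ Then $\|X_t\|\to0$ as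 $t\to\infty$ almost surely. -/

import Mathlib

open MeasureTheory ProbabilityTheory Filter Topology
open scoped NNReal Matrix

universe u

/-- A real square matrix is Hurwitz if all its (complex) eigenvalues have strictly negative
real part. -/
def Hurwitz {d : ℕ} (M : Matrix (Fin d) (Fin d) ℝ) : Prop :=
  ∀ z ∈ spectrum ℂ (M.map Complex.ofReal), z.re < 0

/-- `Q` is a generator (a "Q-matrix") on the finite set `Fin n`: the off-diagonal entries are
nonnegative and the rows sum to zero. -/
structure IsGenerator {n : ℕ} (Q : Matrix (Fin n) (Fin n) ℝ) : Prop where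
  offDiag_nonneg : ∀ i j, i ≠ j → 0 ≤ Q i j
  row_sum : ∀ i, ∑ j, Q i j = 0

/-- `Q` is irreducible: every state can be reached from every state by finitely many jumps of
positive rate. -/
def IsIrreducibleGenerator {n : ℕ} (Q : Matrix (Fin n) (Fin n) ℝ) : Prop :=
  ∀ i j, Relation.ReflTransGen (fun k l => k ≠ l ∧ 0 < Q k l) i j

/-- `p` is an invariant probability vector of the generator `Q`. -/
structure IsInvariantProb {n : ℕ} (Q : Matrix (Fin n) (Fin n) ℝ) (p : Fin n → ℝ) : Prop where
  nonneg : ∀ i, 0 ≤ p i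
  sum_eq_one : ∑ i, p i = 1
  invariant : p ᵥ* Q = 0

/-- `I` is a continuous time Markov chain on `Fin n` with generator `G`, relative to the
filtration `𝓕`: it is adapted, its paths are right-continuous (for the discrete topology on
`Fin n`), and it is Markov with transition semigroup `t ↦ exp (t G)`. -/
structure IsMarkovChain {n : ℕ} {Ω : Type u} {mΩ : MeasurableSpace Ω}
    (G : Matrix (Fin n) (Fin n) ℝ) (μ : Measure Ω) (𝓕 : Filtration ℝ≥0 mΩ)
    (I : ℝ≥0 → Ω → Fin n) : Prop where
  adapted : ∀ t, Measurable[𝓕 t] (I t)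
  right_continuous : ∀ ω t, ∀ᶠ s in 𝓝[≥] t, I s ω = I t ω
  markov : ∀ s t, s ≤ t → ∀ j,
    μ[{ω | I t ω = j}.indicator (fun _ => (1 : ℝ)) | 𝓕 s]
      =ᵐ[μ] fun ω => NormedSpace.exp (((t : ℝ) - (s : ℝ)) • G) (I s ω) j

/-- The path `x` solves `x t = x 0 + ∫₀ᵗ A_{I s} (x s) ds` for all `t ≥ 0`, where the integrand is
required to be integrable on every `[0, t]`. -/
def IsSwitchedSolution {n d : ℕ} (A : Fin n → Matrix (Fin d) (Fin d) ℝ) (I : ℝ≥0 → Fin n)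
    (x : ℝ≥0 → EuclideanSpace ℝ (Fin d)) : Prop :=
  ∀ t : ℝ≥0,
    IntervalIntegrable
      (fun s : ℝ => Matrix.toEuclideanCLM (𝕜 := ℝ) (A (I s.toNNReal)) (x s.toNNReal)) volume 0 t ∧
    x t = x 0 +
      ∫ s in (0 : ℝ)..t, Matrix.toEuclideanCLM (𝕜 := ℝ) (A (I s.toNNReal)) (x s.toNNReal)

/-!
The proof compares the switched system with the averaged one over time steps of a fixed length `h`.

Since `Ā = ∑ i, p i • A i` is Hurwitz, there is a positive definite quadratic form `⟨P x, x⟩` with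
`2 ⟨P x, Ā x⟩ ≤ -c ‖x‖²` (`Hurwitz.exists_lyapunov`): for small `ε` the powers of `1 + ε Ā` tend to
zero by Gelfand's formula, and `P` is a finite sum of squares of these powers.

Over one step, with `x` the state at its beginning, the form changes by `h · 2 ⟨P x, Ā x⟩`, up to an
error `O(h²) ‖x‖²` and a fluctuation
`2 ∑ i, ⟨P x, A i x⟩ ∫ (1{I u = i} - p i) du` (`inner_le_of_integral_eq`). The function
`1{· = i} - p i` is `Q w` for some `w`, because an irreducible generator satisfies the Fredholm
alternative (`IsGenerator.exists_poisson`). For the chain with generator `r Q`, Dynkin's formula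
tested against random variables from the past (`IsMarkovChain.integral_mul_integral_eq`) shows that
the fluctuation has expectation of order `𝔼 ‖x‖² / r`. Choosing `h` small in terms of `P` and `A`,
and then `r` large in terms of `h`, one gets
`𝔼 ⟨P X, X⟩` at time `t + h` at most `𝔼 ⟨P X, X⟩ - δ 𝔼 ‖X‖²` at time `t`, with `δ > 0`
(`IsMarkovChain.integral_inner_le`). Hence `∑ k, 𝔼 ‖X (k h)‖²` is finite, so that `X (k h) → 0`
almost surely, and between grid points the norm at most doubles.

The argument needs second moments and adaptedness of the solution. For the former, the initial
value is truncated: by linearity, multiplying a solution by the indicator of `{‖X 0‖ ≤ K}` gives a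
solution, and these events exhaust the probability space. The latter follows from the convergence
of Picard's iteration on each step (`measurable_of_integral_eq`).
-/

/-! ### Irreducible generators and Hurwitz matrices -/

/-- Maximum principle: the harmonic functions of an irreducible generator are constant. -/
theorem IsGenerator.eq_of_mulVec_eq_zero {n : ℕ} {Q : Matrix (Fin n) (Fin n) ℝ}
    (hQ : IsGenerator Q) (hirr : IsIrreducibleGenerator Q) {f : Fin n → ℝ}
    (hf : Q *ᵥ f = 0) (i j : Fin n) : f i = f j := by
  obtain ⟨m, -, hm⟩ := Finset.exists_max_image Finset.univ f ⟨i, Finset.mem_univ i⟩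
  have step : ∀ k l, f k = f m → k ≠ l ∧ 0 < Q k l → f l = f m := by
    intro k l hk hkl
    have h0 : ∑ j, Q k j * (f j - f m) = 0 := by
      have h1 : ∑ j, Q k j * f j = 0 := congrFun hf k
      simp only [mul_sub, Finset.sum_sub_distrib, h1, ← Finset.sum_mul, hQ.row_sum, zero_mul,
        sub_zero]
    have hle : ∀ j ∈ Finset.univ, Q k j * (f j - f m) ≤ 0 := by
      intro j _
      by_cases hkj : k = j
      · subst hkj; simp [hk]
      · exact mul_nonpos_of_nonneg_of_nonpos (hQ.offDiag_nonneg k j hkj)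
          (sub_nonpos.2 (hm j (Finset.mem_univ j)))
    have := (Finset.sum_eq_zero_iff_of_nonpos hle).1 h0 l (Finset.mem_univ l)
    rcases mul_eq_zero.1 this with h | h
    · exact absurd h hkl.2.ne'
    · exact sub_eq_zero.1 h
  have all : ∀ l, f l = f m := by
    intro l
    induction hirr m l with
    | refl => rfl
    | tail _ hkl ih => exact step _ _ ih hkl
  rw [all i, all j]

/-- Fredholm alternative for the Poisson equation of an irreducible generator: the kernel of `Q`
consists of the constants, so its range has codimension one and fills the hyperplane orthogonal to
the invariant vector. -/
theorem IsGenerator.exists_poisson {n : ℕ} {Q : Matrix (Fin n) (Fin n) ℝ}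
    (hQ : IsGenerator Q) (hirr : IsIrreducibleGenerator Q) {p : Fin n → ℝ}
    (hp : IsInvariantProb Q p) {g : Fin n → ℝ} (hg : p ⬝ᵥ g = 0) :
    ∃ w : Fin n → ℝ, Q *ᵥ w = g := by
  let φ : (Fin n → ℝ) →ₗ[ℝ] ℝ := dotProductBilin ℝ ℝ p
  have hφ : ∀ x, φ x = p ⬝ᵥ x := fun x => rfl
  have hle : LinearMap.range Q.mulVecLin ≤ LinearMap.ker φ := by
    rintro _ ⟨w, rfl⟩
    rw [LinearMap.mem_ker, hφ, Matrix.mulVecLin_apply, Matrix.dotProduct_mulVec, hp.invariant,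
      zero_dotProduct]
  have hφ1 : φ (fun _ => 1) = 1 := by
    simp [hφ, dotProduct, hp.sum_eq_one]
  have hsurj : Module.finrank ℝ (LinearMap.range φ) = 1 := by
    have : LinearMap.range φ = ⊤ := by
      rw [LinearMap.range_eq_top]
      intro c
      exact ⟨c • fun _ => 1, by rw [map_smul, hφ1]; simp⟩
    rw [this]; simp
  have hker : Module.finrank ℝ (LinearMap.ker Q.mulVecLin) ≤ 1 := by
    have hsub : LinearMap.ker Q.mulVecLin ≤ Submodule.span ℝ {fun _ => (1 : ℝ)} := by
      intro f hf
      rw [Submodule.mem_span_singleton]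
      rcases isEmpty_or_nonempty (Fin n) with hE | ⟨⟨i⟩⟩
      · exact ⟨0, funext fun i => hE.elim i⟩
      · refine ⟨f i, funext fun j => ?_⟩
        have := hQ.eq_of_mulVec_eq_zero hirr (f := f) (by simpa using hf) i j
        simpa using this
    exact (Submodule.finrank_mono hsub).trans ((finrank_span_le_card _).trans (by simp))
  have h1 := LinearMap.finrank_range_add_finrank_ker Q.mulVecLin
  have h2 := LinearMap.finrank_range_add_finrank_ker φ
  have heq : LinearMap.range Q.mulVecLin = LinearMap.ker φ :=
    Submodule.eq_of_le_of_finrank_le hle (by omega)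
  have hmem : g ∈ LinearMap.range Q.mulVecLin := by
    rw [heq, LinearMap.mem_ker, hφ, hg]
  obtain ⟨w, hw⟩ := hmem
  exact ⟨w, hw⟩

section
attribute [local instance] Matrix.linftyOpNormedRing Matrix.linftyOpNormedAlgebra

theorem tendsto_pow_of_spectralRadius_lt_one {A : Type*} [NormedRing A] [NormedAlgebra ℂ A]
    [CompleteSpace A] {a : A} (h : spectralRadius ℂ a < 1) :
    Tendsto (fun k : ℕ => a ^ k) atTop (𝓝 0) := by
  obtain ⟨ρ, h1, h2⟩ := ENNReal.lt_iff_exists_nnreal_btwn.1 h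
  have hρ : ρ < 1 := by exact_mod_cast h2
  have hev := (spectrum.pow_nnnorm_pow_one_div_tendsto_nhds_spectralRadius a).eventually_lt_const h1
  rw [tendsto_zero_iff_norm_tendsto_zero]
  refine squeeze_zero' (Eventually.of_forall fun _ => norm_nonneg _) ?_
    (tendsto_pow_atTop_nhds_zero_of_lt_one ρ.coe_nonneg (by exact_mod_cast hρ))
  filter_upwards [hev, eventually_gt_atTop 0] with k hk hk0
  have hk0' : (0 : ℝ) < k := by exact_mod_cast hk0
  have := ENNReal.rpow_lt_rpow hk hk0'
  rw [← ENNReal.rpow_mul, one_div, inv_mul_cancel₀ hk0'.ne', ENNReal.rpow_one,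
    ENNReal.rpow_natCast] at this
  have h3 : ‖a ^ k‖₊ < ρ ^ k := by exact_mod_cast this
  exact_mod_cast h3.le

/-- Explicit Euler steps `1 + ε M` of a Hurwitz matrix have spectral radius below one for small
`ε`, since `|1 + ε z|² = 1 + 2 ε Re z + ε² |z|²`; hence their powers tend to zero. -/
theorem Hurwitz.exists_tendsto_pow {d : ℕ} {M : Matrix (Fin d) (Fin d) ℝ} (hM : Hurwitz M) :
    ∃ ε : ℝ, 0 < ε ∧ Tendsto (fun k : ℕ => (1 + ε • M) ^ k) atTop (𝓝 0) := by
  set C := M.map Complex.ofReal with hC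
  have hev : ∀ᶠ ε : ℝ in 𝓝[>] 0, ∀ z ∈ spectrum ℂ C, ‖1 + (ε : ℂ) * z‖ < 1 := by
    rw [eventually_all_finite (Matrix.finite_spectrum C)]
    intro z hz
    have hre := hM z hz
    have hlim : Tendsto (fun ε : ℝ => 2 * z.re + ε * Complex.normSq z) (𝓝[>] 0)
        (𝓝 (2 * z.re)) := by
      have : Continuous fun ε : ℝ => 2 * z.re + ε * Complex.normSq z := by fun_prop
      simpa using (this.tendsto 0).mono_left nhdsWithin_le_nhds
    filter_upwards [hlim.eventually_lt_const (by linarith : 2 * z.re < 0),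
      self_mem_nhdsWithin] with ε h1 h2
    have h2' : 0 < ε := h2
    rw [← sq_lt_one_iff₀ (norm_nonneg _), ← Complex.normSq_eq_norm_sq, Complex.normSq_apply]
    rw [Complex.normSq_apply] at h1
    simp
    nlinarith [mul_neg_of_pos_of_neg h2' h1]
  obtain ⟨ε, hε, hε0⟩ := (hev.and self_mem_nhdsWithin).exists
  refine ⟨ε, hε0, ?_⟩
  have hsr : spectralRadius ℂ (1 + (ε : ℂ) • C) < 1 := by
    rcases (spectrum ℂ (1 + (ε : ℂ) • C)).eq_empty_or_nonempty with he | hne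
    · simp only [spectralRadius, he]
      simp
    · have hε' : (ε : ℂ) ≠ 0 := by exact_mod_cast (ne_of_gt hε0)
      have key : ∀ w ∈ spectrum ℂ (1 + (ε : ℂ) • C), ‖w‖₊ < 1 := by
        intro w hw
        have h1 : (w - 1) ∈ spectrum ℂ ((ε : ℂ) • C) := by
          rw [← spectrum.add_mem_add_iff (s := 1), map_one, sub_add_cancel]
          exact hw
        have h2 := spectrum.unit_smul_eq_smul C (Units.mk0 (ε : ℂ) hε')
        have h3 : (ε : ℂ) • C = (Units.mk0 (ε : ℂ) hε') • C := rfl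
        rw [h3, h2] at h1
        obtain ⟨z, hz, hzw⟩ := h1
        have hzw' : (ε : ℂ) * z = w - 1 := hzw
        have := hε z hz
        rw [hzw'] at this
        have h5 : ‖w‖ < 1 := by simpa using this
        exact_mod_cast h5
      exact_mod_cast spectrum.spectralRadius_lt_of_forall_lt_of_nonempty hne key
  have ht := tendsto_pow_of_spectralRadius_lt_one hsr
  have hpow : ∀ k : ℕ, (1 + (ε : ℂ) • C) ^ k = ((1 + ε • M) ^ k).map Complex.ofReal := by
    intro k
    have h1 : (1 + (ε : ℂ) • C) = Complex.ofRealHom.mapMatrix (1 + ε • M) := by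
      ext i j
      by_cases hij : i = j <;> simp [hC, hij]
    rw [h1, ← map_pow]
    rfl
  refine tendsto_pi_nhds.2 fun i => tendsto_pi_nhds.2 fun j => ?_
  have h1 := (tendsto_pi_nhds.1 (tendsto_pi_nhds.1 ht i) j)
  have h2 := (Complex.continuous_re.tendsto _).comp h1
  refine h2.congr fun k => ?_
  rw [Function.comp_apply, hpow]
  rfl

end

/-- Lyapunov's theorem: a Hurwitz matrix `M` admits a positive definite quadratic form that
decreases along the linear flow of `M`. -/
theorem Hurwitz.exists_lyapunov {d : ℕ} {M : Matrix (Fin d) (Fin d) ℝ} (hM : Hurwitz M) :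
    ∃ P : EuclideanSpace ℝ (Fin d) →L[ℝ] EuclideanSpace ℝ (Fin d),
      (∀ x y, inner ℝ (P x) y = inner ℝ (P y) x) ∧ (∀ x, ‖x‖ ^ 2 ≤ inner ℝ (P x) x) ∧
      ∃ c : ℝ, 0 < c ∧
        ∀ x, 2 * inner ℝ (P x) (Matrix.toEuclideanCLM (𝕜 := ℝ) M x) ≤ -c * ‖x‖ ^ 2 := by
  obtain ⟨ε, hε, ht⟩ := hM.exists_tendsto_pow
  set T := Matrix.toEuclideanCLM (𝕜 := ℝ) (1 + ε • M) with hT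
  have htT : Tendsto (fun k : ℕ => T ^ k) atTop (𝓝 0) := by
    let Φ : Matrix (Fin d) (Fin d) ℝ →ₗ[ℝ]
      (EuclideanSpace ℝ (Fin d) →L[ℝ] EuclideanSpace ℝ (Fin d)) :=
      (Matrix.toEuclideanCLM (n := Fin d) (𝕜 := ℝ)).toAlgEquiv.toLinearMap
    have hc : Continuous Φ := LinearMap.continuous_of_finiteDimensional Φ
    have := (hc.tendsto 0).comp ht
    rw [map_zero] at this
    refine this.congr fun k => ?_
    exact map_pow (Matrix.toEuclideanCLM (n := Fin d) (𝕜 := ℝ)) _ k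
  rw [tendsto_zero_iff_norm_tendsto_zero] at htT
  obtain ⟨N, hN, hN0⟩ := ((htT.eventually_lt_const (by norm_num : (0 : ℝ) < 1 / 2)).and
    (eventually_gt_atTop 0)).exists
  -- The form `⟨P x, x⟩ = ∑_{k < N} ‖T ^ k x‖ ^ 2` telescopes along `T`.
  set P := ∑ k ∈ Finset.range N, (ContinuousLinearMap.adjoint (T ^ k)) ∘L (T ^ k) with hP
  have hPi : ∀ x y, inner ℝ (P x) y = ∑ k ∈ Finset.range N, inner ℝ ((T ^ k) x) ((T ^ k) y) := by
    intro x y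
    simp [hP, sum_inner, ContinuousLinearMap.adjoint_inner_left]
  have hPx : ∀ x, inner ℝ (P x) x = ∑ k ∈ Finset.range N, ‖(T ^ k) x‖ ^ 2 := by
    intro x; simp [hPi]
  have hsymm : ∀ x y, inner ℝ (P x) y = inner ℝ (P y) x := by
    intro x y
    rw [hPi, hPi]
    exact Finset.sum_congr rfl fun k _ => real_inner_comm _ _
  have hTx : ∀ x, T x = x + ε • Matrix.toEuclideanCLM (𝕜 := ℝ) M x := by
    intro x
    simp [hT]
  refine ⟨P, hsymm, fun x => ?_, 3 / (4 * ε), by positivity, fun x => ?_⟩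
  · rw [hPx]
    have := Finset.single_le_sum (f := fun k => ‖(T ^ k) x‖ ^ 2) (fun k _ => by positivity)
      (Finset.mem_range.2 hN0)
    simpa using this
  · set v := Matrix.toEuclideanCLM (𝕜 := ℝ) M x with hv
    have h1 : inner ℝ (P (T x)) (T x) = inner ℝ (P x) x - ‖x‖ ^ 2 + ‖(T ^ N) x‖ ^ 2 := by
      have h := Finset.sum_range_sub (fun k => ‖(T ^ k) x‖ ^ 2) N
      rw [Finset.sum_sub_distrib] at h
      have h' : ∀ k, (T ^ k) (T x) = (T ^ (k + 1)) x := fun k => by rw [pow_succ]; rfl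
      simp only [hPx, h']
      simp only [pow_zero, one_apply_eq_self] at h
      linarith
    have h2 : ‖(T ^ N) x‖ ^ 2 ≤ 1 / 4 * ‖x‖ ^ 2 := by
      have := (T ^ N).le_of_opNorm_le hN.le x
      calc ‖(T ^ N) x‖ ^ 2 ≤ (1 / 2 * ‖x‖) ^ 2 := by gcongr
        _ = _ := by ring
    have h3 : inner ℝ (P (T x)) (T x)
        = inner ℝ (P x) x + ε * (2 * inner ℝ (P x) v) + ε ^ 2 * inner ℝ (P v) v := by
      rw [hTx]
      simp only [map_add, map_smul, inner_add_left, inner_add_right, inner_smul_left,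
        inner_smul_right, ← hv, hsymm v x, conj_trivial]
      ring
    have h4 : 0 ≤ inner ℝ (P v) v := by rw [hPx]; positivity
    have h5 : ε * (2 * inner ℝ (P x) v) ≤ ε * (-(3 / (4 * ε)) * ‖x‖ ^ 2) := by
      have : ε * (-(3 / (4 * ε)) * ‖x‖ ^ 2) = -(3 / 4) * ‖x‖ ^ 2 := by field_simp
      rw [this]
      nlinarith [mul_nonneg (sq_nonneg ε) h4]
    exact le_of_mul_le_mul_left h5 hε

/-! ### Linear integral equations over a short time -/

section Deterministic

variable {E : Type*} [NormedAddCommGroup E] [NormedSpace ℝ E]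
  {B : ℝ → E →L[ℝ] E} {y : ℝ → E} {M a h : ℝ}

/-- A priori bound: over a time `h` with `M * h ≤ 1 / 2` the norm of a solution at most doubles. -/
theorem norm_le_two_mul_of_integral_eq (hB : ∀ s, ‖B s‖ ≤ M) (hh : 0 ≤ h) (hMh : M * h ≤ 1 / 2)
    (hint : IntervalIntegrable (fun u => B u (y u)) volume a (a + h))
    (hy : ∀ s ∈ Set.Icc a (a + h), y s = y a + ∫ u in a..s, B u (y u))
    {s : ℝ} (hs : s ∈ Set.Icc a (a + h)) : ‖y s‖ ≤ 2 * ‖y a‖ := by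
  have hah : a ≤ a + h := by linarith
  have hM : 0 ≤ M := (norm_nonneg _).trans (hB 0)
  have hcont : ContinuousOn y (Set.Icc a (a + h)) := by
    have h1 : IntegrableOn (fun u => B u (y u)) (Set.uIcc a (a + h)) := by
      rw [Set.uIcc_of_le hah, integrableOn_Icc_iff_integrableOn_Ioc]
      exact (intervalIntegrable_iff_integrableOn_Ioc_of_le hah).1 hint
    have h2 := (continuousOn_const (c := y a)).add
      (intervalIntegral.continuousOn_primitive_interval h1)
    rw [Set.uIcc_of_le hah] at h2
    exact h2.congr fun s hs => hy s hs
  -- A maximum point of the norm absorbs its own contribution, because `M * h ≤ 1 / 2`.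
  obtain ⟨t, ht, hmax⟩ := isCompact_Icc.exists_isMaxOn (Set.nonempty_Icc.2 hah) hcont.norm
  have hbound : ‖∫ u in a..t, B u (y u)‖ ≤ M * ‖y t‖ * |t - a| := by
    refine intervalIntegral.norm_integral_le_of_norm_le_const fun u hu => ?_
    rw [Set.uIoc_of_le ht.1] at hu
    have hu' : u ∈ Set.Icc a (a + h) := ⟨hu.1.le, hu.2.trans ht.2⟩
    exact ((B u).le_of_opNorm_le (hB u) _).trans (mul_le_mul_of_nonneg_left (hmax hu') hM)
  rw [abs_of_nonneg (sub_nonneg.2 ht.1)] at hbound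
  have h3 : M * ‖y t‖ * (t - a) ≤ 1 / 2 * ‖y t‖ := by
    have : M * (t - a) ≤ M * h := mul_le_mul_of_nonneg_left (by linarith [ht.2]) hM
    calc M * ‖y t‖ * (t - a) = M * (t - a) * ‖y t‖ := by ring
      _ ≤ _ := mul_le_mul_of_nonneg_right (this.trans hMh) (norm_nonneg _)
  have h4 : ‖y t‖ ≤ ‖y a‖ + ‖∫ u in a..t, B u (y u)‖ := by
    conv_lhs => rw [hy t ht]
    exact norm_add_le _ _
  have h5 : ‖y s‖ ≤ ‖y t‖ := hmax hs
  linarith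

theorem norm_sub_le_of_integral_eq (hB : ∀ s, ‖B s‖ ≤ M) (hh : 0 ≤ h) (hMh : M * h ≤ 1 / 2)
    (hint : IntervalIntegrable (fun u => B u (y u)) volume a (a + h))
    (hy : ∀ s ∈ Set.Icc a (a + h), y s = y a + ∫ u in a..s, B u (y u))
    {s : ℝ} (hs : s ∈ Set.Icc a (a + h)) : ‖y s - y a‖ ≤ 2 * M * h * ‖y a‖ := by
  have hM : 0 ≤ M := (norm_nonneg _).trans (hB 0)
  rw [hy s hs, add_sub_cancel_left]
  have hbound : ‖∫ u in a..s, B u (y u)‖ ≤ M * (2 * ‖y a‖) * |s - a| := by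
    refine intervalIntegral.norm_integral_le_of_norm_le_const fun u hu => ?_
    rw [Set.uIoc_of_le hs.1] at hu
    have hu' : u ∈ Set.Icc a (a + h) := ⟨hu.1.le, hu.2.trans hs.2⟩
    exact (B u).le_of_opNorm_le_of_le (hB u)
      (norm_le_two_mul_of_integral_eq hB hh hMh hint hy hu')
  rw [abs_of_nonneg (sub_nonneg.2 hs.1)] at hbound
  have : M * (2 * ‖y a‖) * (s - a) ≤ M * (2 * ‖y a‖) * h :=
    mul_le_mul_of_nonneg_left (by linarith [hs.2]) (by positivity)
  linarith

/-- One Picard iteration contracts the distance to the solution by the factor `M * h`. -/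
theorem norm_sub_picard_le (hB : ∀ s, ‖B s‖ ≤ M)
    (hint : IntervalIntegrable (fun u => B u (y u)) volume a (a + h))
    (hy : ∀ s ∈ Set.Icc a (a + h), y s = y a + ∫ u in a..s, B u (y u))
    {z : ℝ → E} {δ : ℝ} (hz : ∀ s ∈ Set.Icc a (a + h), ‖y s - z s‖ ≤ δ)
    (hzint : IntervalIntegrable (fun u => B u (z u)) volume a (a + h))
    {s : ℝ} (hs : s ∈ Set.Icc a (a + h)) :
    ‖y s - (y a + ∫ u in a..s, B u (z u))‖ ≤ M * h * δ := by
  have hM : 0 ≤ M := (norm_nonneg _).trans (hB 0)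
  have hδ : 0 ≤ δ := (norm_nonneg _).trans (hz s hs)
  have hsub : Set.uIcc a s ⊆ Set.uIcc a (a + h) := by
    rw [Set.uIcc_of_le hs.1, Set.uIcc_of_le (hs.1.trans hs.2)]
    exact Set.Icc_subset_Icc_right hs.2
  rw [hy s hs, add_sub_add_left_eq_sub,
    ← intervalIntegral.integral_sub (hint.mono_set hsub) (hzint.mono_set hsub)]
  have hbound : ‖∫ u in a..s, (B u (y u) - B u (z u))‖ ≤ M * δ * |s - a| := by
    refine intervalIntegral.norm_integral_le_of_norm_le_const fun u hu => ?_
    rw [Set.uIoc_of_le hs.1] at hu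
    rw [← map_sub]
    exact (B u).le_of_opNorm_le_of_le (hB u) (hz u ⟨hu.1.le, hu.2.trans hs.2⟩)
  rw [abs_of_nonneg (sub_nonneg.2 hs.1)] at hbound
  have : M * δ * (s - a) ≤ M * δ * h :=
    mul_le_mul_of_nonneg_left (by linarith [hs.2]) (by positivity)
  linarith

end Deterministic

/-! ### Measurability of processes and solutions -/

section Measurability

variable {Ω : Type*} [MeasurableSpace Ω] {n : ℕ}

/-- A right-continuous process with finitely many values is jointly measurable, being the limit of
the processes that look up the value at the next point of a grid. -/
theorem measurable_uncurry_of_right_continuous {J : ℝ → Ω → Fin n} (hJ : ∀ s, Measurable (J s))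
    (hr : ∀ ω s, ∀ᶠ u in 𝓝[≥] s, J u ω = J s ω) : Measurable (Function.uncurry J) := by
  have hlim : ∀ s : ℝ, Tendsto (fun k : ℕ => ((⌊s * (k + 1)⌋ : ℝ) + 1) / (k + 1)) atTop
      (𝓝[≥] s) := by
    intro s
    have hpos : ∀ k : ℕ, (0 : ℝ) < k + 1 := fun k => by positivity
    rw [tendsto_nhdsWithin_iff]
    refine ⟨?_, Eventually.of_forall fun k => ?_⟩
    · have h1 : Tendsto (fun k : ℕ => s + 1 / ((k : ℝ) + 1)) atTop (𝓝 s) := by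
        simpa using tendsto_one_div_add_atTop_nhds_zero_nat.const_add s
      refine tendsto_of_tendsto_of_tendsto_of_le_of_le tendsto_const_nhds h1 (fun k => ?_)
        fun k => ?_
      · dsimp only
        rw [le_div_iff₀ (hpos k)]
        exact (Int.lt_floor_add_one _).le
      · dsimp only
        rw [div_le_iff₀ (hpos k), add_mul, one_div, inv_mul_cancel₀ (hpos k).ne']
        linarith [Int.floor_le (s * ((k : ℝ) + 1))]
    · rw [Set.mem_Ici, le_div_iff₀ (hpos k)]
      exact (Int.lt_floor_add_one _).le
  refine measurable_of_tendsto_metrizable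
    (f := fun (k : ℕ) (q : ℝ × Ω) => J (((⌊q.1 * (k + 1)⌋ : ℝ) + 1) / (k + 1)) q.2) (fun k => ?_) ?_
  · have h1 : Measurable fun q : ℤ × Ω => J (((q.1 : ℝ) + 1) / (k + 1)) q.2 :=
      measurable_from_prod_countable_right fun z => hJ (((z : ℝ) + 1) / (k + 1))
    have h2 : Measurable fun q : ℝ × Ω => (⌊q.1 * ((k : ℝ) + 1)⌋, q.2) := by fun_prop
    exact h1.comp h2
  · rw [tendsto_pi_nhds]
    rintro ⟨s, ω⟩
    exact tendsto_const_nhds.congr' (((hlim s).eventually (hr ω s)).mono fun k hk => hk.symm)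

theorem intervalIntegrable_of_measurable_of_norm_le {E : Type*} [NormedAddCommGroup E]
    [MeasurableSpace E] [BorelSpace E] [SecondCountableTopology E] {f : ℝ → E}
    (hf : Measurable f) {a b C : ℝ} (hab : a ≤ b) (hC : ∀ u ∈ Set.Icc a b, ‖f u‖ ≤ C) :
    IntervalIntegrable f volume a b := by
  rw [intervalIntegrable_iff_integrableOn_Ioc_of_le hab]
  refine Measure.integrableOn_of_bounded (M := C) measure_Ioc_lt_top.ne
    hf.aestronglyMeasurable ?_
  filter_upwards [ae_restrict_mem measurableSet_Ioc] with u hu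
  exact hC u ⟨hu.1.le, hu.2⟩

variable {E : Type*} [NormedAddCommGroup E] [NormedSpace ℝ E] [MeasurableSpace E] [BorelSpace E]
  {L : Fin n → E →L[ℝ] E} {J : ℝ → Ω → Fin n}

theorem measurable_switched_apply {α : Type*} [MeasurableSpace α] {i : α → Fin n} {z : α → E}
    (hi : Measurable i) (hz : Measurable z) : Measurable fun q => L (i q) (z q) := by
  have h1 : Measurable fun q : Fin n × E => L q.1 q.2 :=
    measurable_from_prod_countable_right fun k => (L k).continuous.measurable
  exact h1.comp (hi.prodMk hz)

theorem measurable_setIntegral_Ioc [SecondCountableTopology E] {F : ℝ × Ω → E}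
    (hF : Measurable F) (a : ℝ) :
    Measurable fun q : ℝ × Ω => ∫ u in Set.Ioc a q.1, F (u, q.2) := by
  have h1 : ∀ q : ℝ × Ω, ∫ u in Set.Ioc a q.1, F (u, q.2)
      = ∫ u, {v : (ℝ × Ω) × ℝ | v.2 ∈ Set.Ioc a v.1.1}.indicator
          (fun v => F (v.2, v.1.2)) (q, u) := by
    intro q
    rw [← integral_indicator measurableSet_Ioc]
    rfl
  simp_rw [h1]
  have h2 : Measurable ({v : (ℝ × Ω) × ℝ | v.2 ∈ Set.Ioc a v.1.1}.indicator
      (fun v => F (v.2, v.1.2))) := by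
    refine (hF.comp (by fun_prop)).indicator ?_
    exact (measurableSet_lt measurable_const measurable_snd).inter
      (measurableSet_le measurable_snd (measurable_fst.comp measurable_fst))
  exact (h2.stronglyMeasurable.integral_prod_right').measurable

/-- Over a short time the solution of a switched linear equation is a measurable function of its
initial value and of the switching path, as the limit of its Picard iterates. -/
theorem measurable_of_integral_eq [SecondCountableTopology E] {y : ℝ → Ω → E}
    {M a h : ℝ} (hL : ∀ i, ‖L i‖ ≤ M)
    (hh : 0 ≤ h) (hMh : M * h ≤ 1 / 2) (hJ : Measurable (Function.uncurry J))
    (hint : ∀ ω, IntervalIntegrable (fun u => L (J u ω) (y u ω)) volume a (a + h))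
    (hy : ∀ ω, ∀ s ∈ Set.Icc a (a + h), y s ω = y a ω + ∫ u in a..s, L (J u ω) (y u ω))
    (hya : Measurable (y a)) : Measurable (y (a + h)) := by
  have hah : a ≤ a + h := by linarith
  have key : ∀ k : ℕ, ∃ Z : ℝ × Ω → E, Measurable Z ∧
      ∀ ω, ∀ s ∈ Set.Icc a (a + h), ‖y s ω - Z (s, ω)‖ ≤ (1 / 2) ^ k * ‖y a ω‖ := by
    intro k
    induction k with
    | zero =>
      refine ⟨fun q => y a q.2, hya.comp measurable_snd, fun ω s hs => ?_⟩
      refine (norm_sub_le_of_integral_eq (B := fun s => L (J s ω)) (fun s => hL _) hh hMh (hint ω)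
        (hy ω) hs).trans ?_
      rw [pow_zero]
      exact mul_le_mul_of_nonneg_right (by linarith) (norm_nonneg _)
    | succ k ih =>
      obtain ⟨Z, hZ, hZy⟩ := ih
      have hF : Measurable fun q : ℝ × Ω => L (J q.1 q.2) (Z q) :=
        measurable_switched_apply hJ hZ
      refine ⟨fun q => y a q.2 + ∫ u in Set.Ioc a q.1, L (J u q.2) (Z (u, q.2)),
        (hya.comp measurable_snd).add (measurable_setIntegral_Ioc hF a), fun ω s hs => ?_⟩
      have hZint : IntervalIntegrable (fun u => L (J u ω) (Z (u, ω))) volume a (a + h) := by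
        refine intervalIntegrable_of_measurable_of_norm_le
          (C := M * ((1 / 2) ^ k * ‖y a ω‖ + 2 * ‖y a ω‖)) (hF.comp measurable_prodMk_right) hah
          fun u hu => (L _).le_of_opNorm_le_of_le (hL _) ?_
        have h1 := hZy ω u hu
        have h2 := norm_le_two_mul_of_integral_eq (B := fun s => L (J s ω)) (fun s => hL _) hh hMh
          (hint ω) (hy ω) hu
        have h3 : ‖Z (u, ω)‖ ≤ ‖y u ω - Z (u, ω)‖ + ‖y u ω‖ := by
          rw [norm_sub_rev]
          exact norm_le_norm_sub_add _ _
        linarith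
      have h4 := norm_sub_picard_le (B := fun s => L (J s ω)) (fun s => hL _) (hint ω) (hy ω)
        (hZy ω) hZint hs
      rw [intervalIntegral.integral_of_le hs.1] at h4
      refine h4.trans ?_
      rw [pow_succ']
      calc M * h * ((1 / 2) ^ k * ‖y a ω‖) ≤ 1 / 2 * ((1 / 2) ^ k * ‖y a ω‖) :=
            mul_le_mul_of_nonneg_right hMh (by positivity)
        _ = _ := by ring
  choose Z hZ hZy using key
  refine measurable_of_tendsto_metrizable (f := fun k ω => Z k (a + h, ω))
    (fun k => (hZ k).comp measurable_prodMk_left) ?_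
  rw [tendsto_pi_nhds]
  intro ω
  rw [tendsto_iff_norm_sub_tendsto_zero]
  refine squeeze_zero (fun _ => norm_nonneg _) (fun k => ?_)
    (by simpa using ((tendsto_pow_atTop_nhds_zero_of_lt_one (r := (1 / 2 : ℝ)) (by norm_num)
      (by norm_num)).mul_const ‖y a ω‖))
  rw [norm_sub_rev]
  simpa using hZy k ω (a + h) (Set.right_mem_Icc.2 hah)

end Measurability

/-! ### Finite-state Markov chains with right-continuous paths -/

section Markov

variable {n : ℕ} {Ω : Type u} {mΩ : MeasurableSpace Ω} {G : Matrix (Fin n) (Fin n) ℝ}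
  {μ : Measure Ω} {𝓕 : Filtration ℝ≥0 mΩ} {I : ℝ≥0 → Ω → Fin n}

/-- The process stopped at the deterministic time `T` is jointly measurable for the information
available at `T`, that is, the chain is progressively measurable. -/
theorem IsMarkovChain.measurable_uncurry_min (hI : IsMarkovChain G μ 𝓕 I) (T : ℝ≥0) :
    Measurable[MeasurableSpace.prod inferInstance (𝓕 T)]
      (Function.uncurry fun (s : ℝ) ω => I (min s T).toNNReal ω) := by
  refine @measurable_uncurry_of_right_continuous Ω (𝓕 T) n _ (fun s => ?_) fun ω s => ?_
  · refine (hI.adapted _).mono (𝓕.mono ?_) le_rfl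
    rw [Real.toNNReal_le_iff_le_coe]
    exact min_le_right _ _
  · have hc : Continuous fun u : ℝ => (min u T).toNNReal := by fun_prop
    have ht : Tendsto (fun u : ℝ => (min u T).toNNReal) (𝓝[≥] s) (𝓝[≥] (min s T).toNNReal) := by
      refine tendsto_nhdsWithin_iff.2 ⟨hc.continuousWithinAt, ?_⟩
      filter_upwards [self_mem_nhdsWithin] with u hu
      exact Real.toNNReal_le_toNNReal (min_le_min_right _ hu)
    exact ht.eventually (hI.right_continuous ω _)

theorem IsMarkovChain.measurable_uncurry (hI : IsMarkovChain G μ 𝓕 I) :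
    Measurable (Function.uncurry fun (s : ℝ) ω => I s.toNNReal ω) := by
  refine measurable_uncurry_of_right_continuous
    (fun s => (hI.adapted _).mono (𝓕.le _) le_rfl) fun ω s => ?_
  have ht : Tendsto Real.toNNReal (𝓝[≥] s) (𝓝[≥] s.toNNReal) := by
    refine tendsto_nhdsWithin_iff.2 ⟨continuous_real_toNNReal.continuousWithinAt, ?_⟩
    filter_upwards [self_mem_nhdsWithin] with u hu
    exact Real.toNNReal_le_toNNReal hu
  exact ht.eventually (hI.right_continuous ω _)

theorem integrable_mul_comp_fin {Y : Ω → ℝ} (hY : Integrable Y μ) {i : Ω → Fin n}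
    (hi : Measurable i) (w : Fin n → ℝ) : Integrable (fun ω => Y ω * w (i ω)) μ :=
  hY.mul_bdd (c := ‖w‖) ((measurable_of_countable w).comp hi).aestronglyMeasurable
    (Eventually.of_forall fun _ => norm_le_pi_norm w _)

theorem IsMarkovChain.measurable_eval (hI : IsMarkovChain G μ 𝓕 I) (t : ℝ≥0) :
    Measurable (I t) :=
  (hI.adapted t).mono (𝓕.le t) le_rfl

/-- The Markov property tested against an integrable random variable from the past. -/
theorem IsMarkovChain.integral_mul_eq [IsProbabilityMeasure μ]
    (hI : IsMarkovChain G μ 𝓕 I) {s t : ℝ≥0} (hst : s ≤ t)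
    {Y : Ω → ℝ} (hYm : StronglyMeasurable[𝓕 s] Y) (hY : Integrable Y μ) (w : Fin n → ℝ) :
    ∫ ω, Y ω * w (I t ω) ∂μ
      = ∫ ω, Y ω * (NormedSpace.exp (((t : ℝ) - (s : ℝ)) • G) *ᵥ w) (I s ω) ∂μ := by
  have hind : ∀ j, Integrable ({ω | I t ω = j}.indicator (fun _ => (1 : ℝ))) μ := fun j =>
    (integrable_const _).indicator ((hI.measurable_eval t) (measurableSet_singleton j))
  have hYind : ∀ j, Integrable (Y * {ω | I t ω = j}.indicator (fun _ => (1 : ℝ))) μ := by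
    intro j
    convert integrable_mul_comp_fin hY (hI.measurable_eval t) (Pi.single j 1) using 2 with ω
    simp [Set.indicator_apply, Pi.single_apply]
  set R := NormedSpace.exp (((t : ℝ) - (s : ℝ)) • G) with hR
  have hYR : ∀ j, Integrable (fun ω => Y ω * R (I s ω) j) μ := fun j =>
    integrable_mul_comp_fin hY (hI.measurable_eval s) fun i => R i j
  have hj : ∀ j, ∫ ω, Y ω * {ω | I t ω = j}.indicator (fun _ => (1 : ℝ)) ω ∂μ
      = ∫ ω, Y ω * R (I s ω) j ∂μ := by
    intro j
    have h1 := condExp_mul_of_stronglyMeasurable_left hYm (hYind j) (hind j)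
    calc _ = ∫ ω, (μ[Y * {ω | I t ω = j}.indicator (fun _ => (1 : ℝ)) | 𝓕 s]) ω ∂μ :=
          (integral_condExp (𝓕.le s)).symm
      _ = _ := by
        refine integral_congr_ae ?_
        filter_upwards [h1, hI.markov s t hst j] with ω h1 h2
        rw [h1, Pi.mul_apply, h2]
  have hL : ∀ ω, Y ω * w (I t ω)
      = ∑ j, w j * (Y ω * {ω | I t ω = j}.indicator (fun _ => (1 : ℝ)) ω) := by
    intro ω
    simp [Set.indicator_apply, mul_comm]
  have hRw : ∀ ω, Y ω * (R *ᵥ w) (I s ω) = ∑ j, w j * (Y ω * R (I s ω) j) := by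
    intro ω
    simp only [Matrix.mulVec, dotProduct, Finset.mul_sum]
    exact Finset.sum_congr rfl fun j _ => by ring
  simp_rw [hL, hRw]
  refine (integral_finsetSum _ fun j _ => (hYind j).const_mul _).trans
    (Eq.trans ?_ (integral_finsetSum _ fun j _ => (hYR j).const_mul _).symm)
  refine Finset.sum_congr rfl fun j _ => ?_
  exact (integral_const_mul _ _).trans ((congrArg _ (hj j)).trans (integral_const_mul _ _).symm)

section
attribute [local instance] Matrix.linftyOpNormedRing Matrix.linftyOpNormedAlgebra

theorem hasDerivAt_sum_mul_exp_mulVec (c w : Fin n → ℝ) (s u : ℝ) :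
    HasDerivAt (fun v : ℝ => ∑ i, c i * (NormedSpace.exp ((v - s) • G) *ᵥ w) i)
      (∑ i, c i * (NormedSpace.exp ((u - s) • G) *ᵥ (G *ᵥ w)) i) u := by
  let φ : Matrix (Fin n) (Fin n) ℝ →ₗ[ℝ] ℝ :=
    { toFun := fun N => ∑ i, c i * (N *ᵥ w) i
      map_add' := fun N N' => by
        simp [Matrix.add_mulVec, mul_add, Finset.sum_add_distrib]
      map_smul' := fun a N => by
        simp only [Matrix.smul_mulVec, Pi.smul_apply, smul_eq_mul, RingHom.id_apply,
          Finset.mul_sum]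
        exact Finset.sum_congr rfl fun i _ => by ring }
  have h1 : HasDerivAt (fun v : ℝ => NormedSpace.exp ((v - s) • G))
      (NormedSpace.exp ((u - s) • G) * G) u := by
    have := (hasDerivAt_exp_smul_const (𝕂 := ℝ) G (u - s)).scomp u ((hasDerivAt_id u).sub_const s)
    rw [one_smul] at this
    exact this
  have h2 := φ.toContinuousLinearMap.hasFDerivAt.comp_hasDerivAt u h1
  refine h2.congr_deriv ?_
  simp only [Matrix.mulVec_mulVec]
  rfl

end

/-- Dynkin's formula for a finite-state chain, tested against a random variable from the past:
`w (I t) - ∫₀ᵗ (G w) (I u) du` has increments orthogonal to the past. -/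
theorem IsMarkovChain.integral_mul_integral_eq [IsProbabilityMeasure μ]
    (hI : IsMarkovChain G μ 𝓕 I) {s t : ℝ≥0}
    (hst : s ≤ t) {Y : Ω → ℝ} (hYm : StronglyMeasurable[𝓕 s] Y) (hY : Integrable Y μ)
    (w : Fin n → ℝ) :
    ∫ ω, Y ω * (∫ u in (s : ℝ)..t, (G *ᵥ w) (I u.toNNReal ω)) ∂μ
      = ∫ ω, Y ω * (w (I t ω) - w (I s ω)) ∂μ := by
  have hst' : (s : ℝ) ≤ t := hst
  set g := G *ᵥ w with hg
  let c : Fin n → ℝ := fun i => ∫ ω, Y ω * (Pi.single i (1 : ℝ) : Fin n → ℝ) (I s ω) ∂μ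
  have hc : ∀ v : Fin n → ℝ, ∫ ω, Y ω * v (I s ω) ∂μ = ∑ i, c i * v i := by
    intro v
    have h1 : ∀ ω, Y ω * v (I s ω)
        = ∑ i, (Y ω * (Pi.single i (1 : ℝ) : Fin n → ℝ) (I s ω)) * v i := by
      intro ω
      simp [Pi.single_apply]
    simp_rw [h1]
    rw [integral_finsetSum _ fun i _ =>
      (integrable_mul_comp_fin hY (hI.measurable_eval s) _).mul_const _]
    simp_rw [integral_mul_const]
    rfl
  have hprod : Integrable (fun q : Ω × ℝ => Y q.1 * g (I q.2.toNNReal q.1))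
      (μ.prod (volume.restrict (Set.Ioc (s : ℝ) t))) := by
    have h1 : Integrable (fun q : Ω × ℝ => Y q.1 * 1)
        (μ.prod (volume.restrict (Set.Ioc (s : ℝ) t))) :=
      hY.mul_prod (integrable_const (1 : ℝ))
    simp only [mul_one] at h1
    refine h1.mul_bdd (c := ‖g‖) ?_ (Eventually.of_forall fun _ => norm_le_pi_norm g _)
    exact ((measurable_of_countable g).comp
      (hI.measurable_uncurry.comp measurable_swap)).aestronglyMeasurable
  have hswap : ∫ ω, Y ω * (∫ u in (s : ℝ)..t, g (I u.toNNReal ω)) ∂μ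
      = ∫ u in (s : ℝ)..t, ∫ ω, Y ω * g (I u.toNNReal ω) ∂μ := by
    simp_rw [intervalIntegral.integral_of_le hst', ← integral_const_mul]
    exact integral_integral_swap hprod
  have hinner : ∀ u ∈ Set.uIcc (s : ℝ) t, ∫ ω, Y ω * g (I u.toNNReal ω) ∂μ
      = ∑ i, c i * (NormedSpace.exp ((u - s) • G) *ᵥ g) i := by
    intro u hu
    rw [Set.uIcc_of_le hst'] at hu
    have hu0 : 0 ≤ u := s.coe_nonneg.trans hu.1
    rw [hI.integral_mul_eq (NNReal.le_toNNReal_of_coe_le hu.1) hYm hY g,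
      Real.coe_toNNReal _ hu0, hc]
  rw [hswap, intervalIntegral.integral_congr hinner]
  have hcont : Continuous fun u : ℝ => ∑ i, c i * (NormedSpace.exp ((u - s) • G) *ᵥ g) i :=
    continuous_iff_continuousAt.2 fun u => (hasDerivAt_sum_mul_exp_mulVec c g s u).continuousAt
  rw [intervalIntegral.integral_eq_sub_of_hasDerivAt
    (fun u _ => hasDerivAt_sum_mul_exp_mulVec c w s u) (hcont.intervalIntegrable _ _)]
  simp_rw [mul_sub]
  rw [integral_sub (integrable_mul_comp_fin hY (hI.measurable_eval t) w)
    (integrable_mul_comp_fin hY (hI.measurable_eval s) w), hI.integral_mul_eq hst hYm hY w, hc, hc]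
  simp

/-- Averaging: if `g = Q w`, then the occupation integral of `g` along the chain with generator
`r Q` is small, of order `1 / r`, conditionally on the past. -/
theorem IsMarkovChain.abs_integral_mul_integral_le [IsProbabilityMeasure μ]
    {Q : Matrix (Fin n) (Fin n) ℝ} {r : ℝ}
    (hr : 0 < r) (hI : IsMarkovChain (r • Q) μ 𝓕 I) {s t : ℝ≥0} (hst : s ≤ t) {Y : Ω → ℝ}
    (hYm : StronglyMeasurable[𝓕 s] Y) (hY : Integrable Y μ) (w : Fin n → ℝ) :
    |∫ ω, Y ω * (∫ u in (s : ℝ)..t, (Q *ᵥ w) (I u.toNNReal ω)) ∂μ|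
      ≤ 2 * ‖w‖ / r * ∫ ω, |Y ω| ∂μ := by
  have h1 := hI.integral_mul_integral_eq hst hYm hY (r⁻¹ • w)
  rw [Matrix.mulVec_smul, Matrix.smul_mulVec, smul_smul, inv_mul_cancel₀ hr.ne', one_smul] at h1
  rw [h1, ← integral_const_mul, ← Real.norm_eq_abs]
  refine norm_integral_le_of_norm_le (hY.abs.const_mul _) (Eventually.of_forall fun ω => ?_)
  have h2 : ∀ i j, ‖(r⁻¹ • w) i - (r⁻¹ • w) j‖ ≤ 2 * ‖w‖ / r := by
    intro i j
    have hi := norm_le_pi_norm w i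
    have hj := norm_le_pi_norm w j
    have h3 : ‖w i - w j‖ ≤ 2 * ‖w‖ := (norm_sub_le _ _).trans (by linarith)
    rw [Pi.smul_apply, Pi.smul_apply, ← smul_sub, norm_smul, Real.norm_of_nonneg (by positivity),
      div_eq_inv_mul]
    gcongr
  rw [norm_mul, mul_comm]
  exact mul_le_mul_of_nonneg_right (h2 _ _) (norm_nonneg _)

end Markov

/-! ### One step of the quadratic form along a switched solution -/

section Step

/-- The integral equation restarted at time `a`, on the real time axis. -/
theorem IsSwitchedSolution.shift {n d : ℕ} {A : Fin n → Matrix (Fin d) (Fin d) ℝ}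
    {I : ℝ≥0 → Fin n} {x : ℝ≥0 → EuclideanSpace ℝ (Fin d)} (hx : IsSwitchedSolution A I x)
    (a h : ℝ≥0) :
    IntervalIntegrable (fun s : ℝ => Matrix.toEuclideanCLM (𝕜 := ℝ) (A (I s.toNNReal))
      (x s.toNNReal)) volume a (a + h) ∧
    ∀ s ∈ Set.Icc (a : ℝ) (a + h), x s.toNNReal = x (a : ℝ).toNNReal +
      ∫ u in (a : ℝ)..s, Matrix.toEuclideanCLM (𝕜 := ℝ) (A (I u.toNNReal)) (x u.toNNReal) := by
  have ha := a.coe_nonneg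
  have hh := h.coe_nonneg
  constructor
  · have := (hx (a + h)).1
    rw [NNReal.coe_add] at this
    refine this.mono_set ?_
    rw [Set.uIcc_of_le (by linarith), Set.uIcc_of_le (by linarith)]
    exact Set.Icc_subset_Icc_left ha
  · intro s hs
    have h1 := hx s.toNNReal
    rw [Real.coe_toNNReal _ (ha.trans hs.1)] at h1
    have h2 := hx a
    rw [h1.2, Real.toNNReal_coe, h2.2, add_assoc,
      intervalIntegral.integral_add_adjacent_intervals h2.1]
    refine h1.1.mono_set ?_
    rw [Set.uIcc_of_le hs.1, Set.uIcc_of_le (ha.trans hs.1)]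
    exact Set.Icc_subset_Icc_left ha

variable {E : Type*} [NormedAddCommGroup E] [InnerProductSpace ℝ E] [CompleteSpace E] {n : ℕ}

/-- Pathwise change of a quadratic form over a short time step `h`: up to `O(h ^ 2)` it is the
drift of the averaged system plus a fluctuation, in which the coefficients depend only on the
state at the beginning of the step and the occupation integrals of the centred indicator functions
`Pi.single i 1 - p i` only on the switching path. -/
theorem inner_le_of_integral_eq {L : Fin n → E →L[ℝ] E} {P : E →L[ℝ] E} {p : Fin n → ℝ}
    {M a h c : ℝ} {J : ℝ → Fin n} {y : ℝ → E}
    (hPs : ∀ x z, inner ℝ (P x) z = inner ℝ (P z) x)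
    (hPc : ∀ x, 2 * inner ℝ (P x) (∑ i, p i • L i x) ≤ -c * ‖x‖ ^ 2)
    (hL : ∀ i, ‖L i‖ ≤ M) (hh : 0 ≤ h) (hMh : M * h ≤ 1 / 2) (hJ : Measurable J)
    (hint : IntervalIntegrable (fun u => L (J u) (y u)) volume a (a + h))
    (hy : ∀ s ∈ Set.Icc a (a + h), y s = y a + ∫ u in a..s, L (J u) (y u)) :
    inner ℝ (P (y (a + h))) (y (a + h)) ≤ inner ℝ (P (y a)) (y a)
      + 2 * ∑ i, inner ℝ (P (y a)) (L i (y a)) *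
        (∫ u in a..(a + h), (Pi.single i 1 - Function.const _ (p i) : Fin n → ℝ) (J u))
      - (h * c - 8 * ‖P‖ * M ^ 2 * h ^ 2) * ‖y a‖ ^ 2 := by
  have hah : a ≤ a + h := by linarith
  have hend : a + h ∈ Set.Icc a (a + h) := Set.right_mem_Icc.2 hah
  have hB : ∀ u, ‖L (J u)‖ ≤ M := fun u => hL _
  have hM : 0 ≤ M := (norm_nonneg _).trans (hB 0)
  set x := y a with hx
  have hsingle : ∀ i, IntervalIntegrable (fun u => (Pi.single i 1 : Fin n → ℝ) (J u)) volume a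
      (a + h) := fun i =>
    intervalIntegrable_of_measurable_of_norm_le (C := ‖(Pi.single i 1 : Fin n → ℝ)‖)
      ((measurable_of_countable _).comp hJ) hah fun u _ =>
        norm_le_pi_norm (Pi.single i 1 : Fin n → ℝ) (J u)
  have hLx : ∀ u, L (J u) x = ∑ i, (Pi.single i 1 : Fin n → ℝ) (J u) • L i x := by
    intro u
    simp [Pi.single_apply]
  have hsmul : ∀ i, IntervalIntegrable (fun u => (Pi.single i 1 : Fin n → ℝ) (J u) • L i x) volume a
      (a + h) := fun i => ⟨(hsingle i).1.smul_const _, (hsingle i).2.smul_const _⟩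
  have hxint : IntervalIntegrable (fun u => L (J u) x) volume a (a + h) := by
    simp_rw [hLx]
    have := IntervalIntegrable.sum (μ := volume) (a := a) (b := a + h) Finset.univ
      (f := fun i u => (Pi.single i 1 : Fin n → ℝ) (J u) • L i x)
      fun i _ => hsmul i
    simpa [Finset.sum_fn] using this
  have he := norm_sub_le_of_integral_eq (B := fun u => L (J u)) hB hh hMh hint hy hend
  have hR := norm_sub_picard_le (B := fun u => L (J u)) hB hint hy (z := fun _ => x)
    (fun s hs => norm_sub_le_of_integral_eq (B := fun u => L (J u)) hB hh hMh hint hy hs)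
    hxint hend
  set D := ∫ u in a..(a + h), L (J u) x with hD
  rw [← hx] at he hR
  set e := y (a + h) - x with hedef
  set R := y (a + h) - (x + D) with hRdef
  have hye : y (a + h) = x + e := by rw [hedef]; abel
  have heD : e = D + R := by rw [hedef, hRdef]; abel
  have hDsum : D = ∑ i, (∫ u in a..(a + h), (Pi.single i 1 : Fin n → ℝ) (J u)) • L i x := by
    rw [hD]
    simp_rw [hLx]
    rw [intervalIntegral.integral_finsetSum fun i _ => hsmul i]
    simp_rw [intervalIntegral.integral_smul_const]
  have hcentre : ∀ i, ∫ u in a..(a + h), (Pi.single i 1 - Function.const _ (p i) : Fin n → ℝ) (J u)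
      = (∫ u in a..(a + h), (Pi.single i 1 : Fin n → ℝ) (J u)) - h * p i := by
    intro i
    simp_rw [Pi.sub_apply, Function.const_apply]
    rw [intervalIntegral.integral_sub (hsingle i) intervalIntegrable_const]
    simp
  have hPD : inner ℝ (P x) D = ∑ i, inner ℝ (P x) (L i x) *
        (∫ u in a..(a + h), (Pi.single i 1 - Function.const _ (p i) : Fin n → ℝ) (J u))
      + h * inner ℝ (P x) (∑ i, p i • L i x) := by
    rw [hDsum, inner_sum, inner_sum, Finset.mul_sum, ← Finset.sum_add_distrib]
    refine Finset.sum_congr rfl fun i _ => ?_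
    rw [hcentre, inner_smul_right, inner_smul_right]
    ring
  have hq : inner ℝ (P (y (a + h))) (y (a + h)) = inner ℝ (P x) x + 2 * inner ℝ (P x) D
      + 2 * inner ℝ (P x) R + inner ℝ (P e) e := by
    have h1 : inner ℝ (P x) e = inner ℝ (P x) D + inner ℝ (P x) R := by
      rw [heD, inner_add_right]
    rw [hye, map_add, inner_add_left, inner_add_right, inner_add_right, hPs e x, h1]
    ring
  have hPR : inner ℝ (P x) R ≤ 2 * ‖P‖ * M ^ 2 * h ^ 2 * ‖x‖ ^ 2 := by
    calc inner ℝ (P x) R ≤ ‖P x‖ * ‖R‖ := real_inner_le_norm _ _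
      _ ≤ (‖P‖ * ‖x‖) * (M * h * (2 * M * h * ‖x‖)) := by
        gcongr
        exact P.le_opNorm x
      _ = _ := by ring
  have hPe : inner ℝ (P e) e ≤ 4 * ‖P‖ * M ^ 2 * h ^ 2 * ‖x‖ ^ 2 := by
    calc inner ℝ (P e) e ≤ ‖P e‖ * ‖e‖ := real_inner_le_norm _ _
      _ ≤ (‖P‖ * ‖e‖) * ‖e‖ := by
        gcongr
        exact P.le_opNorm e
      _ ≤ (‖P‖ * (2 * M * h * ‖x‖)) * (2 * M * h * ‖x‖) := by gcongr
      _ = _ := by ring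
  have hdrift := mul_le_mul_of_nonneg_left (hPc x) hh
  rw [hq, hPD]
  linarith

end Step

/-! ### Summable second moments -/

theorem summable_of_le_sub_mul {q a : ℕ → ℝ} {δ : ℝ} (hδ : 0 < δ) (hq : ∀ k, 0 ≤ q k)
    (ha : ∀ k, 0 ≤ a k) (h : ∀ k, q (k + 1) ≤ q k - δ * a k) : Summable a := by
  refine summable_of_sum_range_le (c := q 0 / δ) ha fun N => ?_
  have key : ∀ N, δ * ∑ k ∈ Finset.range N, a k ≤ q 0 - q N := by
    intro N
    induction N with
    | zero => simp
    | succ N ih =>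
      rw [Finset.sum_range_succ, mul_add]
      linarith [h N]
  rw [le_div_iff₀ hδ, mul_comm]
  linarith [key N, hq N]

theorem ae_tendsto_zero_of_summable_integral_sq {Ω E : Type*} [MeasurableSpace Ω]
    [NormedAddCommGroup E] {μ : Measure Ω} {Z : ℕ → Ω → E}
    (hint : ∀ k, Integrable (fun ω => ‖Z k ω‖ ^ 2) μ)
    (hsum : Summable fun k => ∫ ω, ‖Z k ω‖ ^ 2 ∂μ) :
    ∀ᵐ ω ∂μ, Tendsto (fun k => ‖Z k ω‖) atTop (𝓝 0) := by
  have hlint : ∀ k, ∫⁻ ω, ENNReal.ofReal (‖Z k ω‖ ^ 2) ∂μ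
      = ENNReal.ofReal (∫ ω, ‖Z k ω‖ ^ 2 ∂μ) := fun k =>
    (ofReal_integral_eq_lintegral_ofReal (hint k)
      (Eventually.of_forall fun _ => by positivity)).symm
  have hmeas : ∀ k, AEMeasurable (fun ω => ENNReal.ofReal (‖Z k ω‖ ^ 2)) μ :=
    fun k => (hint k).aemeasurable.ennreal_ofReal
  have hfin : ∫⁻ ω, ∑' k, ENNReal.ofReal (‖Z k ω‖ ^ 2) ∂μ ≠ ⊤ := by
    rw [lintegral_tsum hmeas]
    simp_rw [hlint]
    rw [← ENNReal.ofReal_tsum_of_nonneg (fun k => integral_nonneg fun _ => by positivity) hsum]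
    exact ENNReal.ofReal_ne_top
  filter_upwards [ae_lt_top' (AEMeasurable.tsum hmeas) hfin] with ω hω
  have h1 := ENNReal.tendsto_atTop_zero_of_tsum_ne_top hω.ne
  have h2 := (ENNReal.tendsto_toReal ENNReal.zero_ne_top).comp h1
  have h3 : Tendsto (fun k => ‖Z k ω‖ ^ 2) atTop (𝓝 0) := by
    refine h2.congr fun k => ?_
    exact ENNReal.toReal_ofReal (by positivity)
  simpa using h3.sqrt

/-! ### Almost sure stability -/

section Bounded

variable {n d : ℕ} {A : Fin n → Matrix (Fin d) (Fin d) ℝ} {Q : Matrix (Fin n) (Fin n) ℝ}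
  {Ω : Type u} {mΩ : MeasurableSpace Ω} {μ : Measure Ω}
  {𝓕 : Filtration ℝ≥0 mΩ} {I : ℝ≥0 → Ω → Fin n} {X : ℝ≥0 → Ω → EuclideanSpace ℝ (Fin d)}

theorem IsSwitchedSolution.norm_le {i : ℝ≥0 → Fin n} {x : ℝ≥0 → EuclideanSpace ℝ (Fin d)}
    (hx : IsSwitchedSolution A i x) {M : ℝ} {h : ℝ≥0}
    (hM : ∀ i, ‖Matrix.toEuclideanCLM (𝕜 := ℝ) (A i)‖ ≤ M) (hMh : M * h ≤ 1 / 2) {a t : ℝ≥0}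
    (hat : a ≤ t) (hta : t ≤ a + h) : ‖x t‖ ≤ 2 * ‖x a‖ := by
  obtain ⟨h1, h2⟩ := hx.shift a h
  have := norm_le_two_mul_of_integral_eq
    (B := fun s : ℝ => Matrix.toEuclideanCLM (𝕜 := ℝ) (A (i s.toNNReal)))
    (y := fun s => x s.toNNReal) (fun s => hM _) h.coe_nonneg hMh h1 h2 (s := t)
    ⟨by exact_mod_cast hat, by exact_mod_cast hta⟩
  simpa using this

/-- Adaptedness of the solution propagates over one step. -/
theorem IsMarkovChain.measurable_solution {G : Matrix (Fin n) (Fin n) ℝ}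
    (hI : IsMarkovChain G μ 𝓕 I)
    (hX : ∀ ω, IsSwitchedSolution A (fun t => I t ω) (fun t => X t ω)) {M : ℝ} {h : ℝ≥0}
    (hM : ∀ i, ‖Matrix.toEuclideanCLM (𝕜 := ℝ) (A i)‖ ≤ M) (hMh : M * h ≤ 1 / 2) {a : ℝ≥0}
    (ha : Measurable[𝓕 a] (X a)) : Measurable[𝓕 (a + h)] (X (a + h)) := by
  have hmin : ∀ s ∈ Set.Icc (a : ℝ) (a + h), (min s ((a + h : ℝ≥0) : ℝ)).toNNReal = s.toNNReal := by
    intro s hs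
    rw [min_eq_left (by simpa using hs.2)]
  have hah : (a : ℝ) ≤ a + h := by linarith [h.coe_nonneg]
  have := @measurable_of_integral_eq Ω (𝓕 (a + h)) n (EuclideanSpace ℝ (Fin d)) _ _ _ _
    (fun i => Matrix.toEuclideanCLM (𝕜 := ℝ) (A i))
    (fun s ω => I (min s ((a + h : ℝ≥0) : ℝ)).toNNReal ω) _ (fun s ω => X s.toNNReal ω) M a h hM
    h.coe_nonneg hMh (hI.measurable_uncurry_min (a + h)) (fun ω => ?_) (fun ω s hs => ?_) ?_
  · have h1 : ((a : ℝ) + h).toNNReal = a + h := by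
      rw [← NNReal.coe_add, Real.toNNReal_coe]
    simpa only [h1] using this
  · refine ((hX ω).shift a h).1.congr fun u hu => ?_
    rw [Set.uIoc_of_le hah] at hu
    simp only [hmin u ⟨hu.1.le, hu.2⟩]
  · rw [((hX ω).shift a h).2 s hs]
    congr 1
    refine intervalIntegral.integral_congr fun u hu => ?_
    rw [Set.uIcc_of_le hs.1] at hu
    simp only [hmin u ⟨hu.1, hu.2.trans hs.2⟩]
  · simp only [Real.toNNReal_coe]
    exact ha.mono (𝓕.mono le_self_add) le_rfl

/-- The expected quadratic form decreases over one step of length `h`: the fluctuation in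
`inner_le_of_integral_eq` has expectation of order `1 / r`. -/
theorem IsMarkovChain.integral_inner_le [IsProbabilityMeasure μ] {r : ℝ} (hr : 0 < r)
    (hI : IsMarkovChain (r • Q) μ 𝓕 I)
    (hX : ∀ ω, IsSwitchedSolution A (fun t => I t ω) (fun t => X t ω))
    {P : EuclideanSpace ℝ (Fin d) →L[ℝ] EuclideanSpace ℝ (Fin d)} {p : Fin n → ℝ}
    {w : Fin n → Fin n → ℝ} {M c : ℝ} {a h : ℝ≥0}
    (hPs : ∀ x z, inner ℝ (P x) z = inner ℝ (P z) x)
    (hPc : ∀ x, 2 * inner ℝ (P x) (∑ i, p i • Matrix.toEuclideanCLM (𝕜 := ℝ) (A i) x)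
      ≤ -c * ‖x‖ ^ 2)
    (hw : ∀ i, Q *ᵥ w i = Pi.single i 1 - Function.const _ (p i))
    (hM : ∀ i, ‖Matrix.toEuclideanCLM (𝕜 := ℝ) (A i)‖ ≤ M) (hMh : M * h ≤ 1 / 2)
    (ha : Measurable[𝓕 a] (X a)) {K : ℝ} (hK : ∀ ω, ‖X a ω‖ ≤ K) :
    ∫ ω, inner ℝ (P (X (a + h) ω)) (X (a + h) ω) ∂μ ≤ ∫ ω, inner ℝ (P (X a ω)) (X a ω) ∂μ
      - (h * c - 8 * ‖P‖ * M ^ 2 * h ^ 2 - 4 * ‖P‖ * M * (∑ i, ‖w i‖) / r)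
        * ∫ ω, ‖X a ω‖ ^ 2 ∂μ := by
  set L := fun i => Matrix.toEuclideanCLM (𝕜 := ℝ) (A i) with hLdef
  have haΩ : Measurable (X a) := ha.mono (𝓕.le a) le_rfl
  have hahΩ : Measurable (X (a + h)) := (hI.measurable_solution hX hM hMh ha).mono (𝓕.le _) le_rfl
  have hquad : ∀ N : EuclideanSpace ℝ (Fin d) →L[ℝ] EuclideanSpace ℝ (Fin d),
      ∀ S : EuclideanSpace ℝ (Fin d) →L[ℝ] EuclideanSpace ℝ (Fin d),
      Continuous fun x => inner ℝ (N x) (S x) := fun N S => by fun_prop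
  have hbound : ∀ (S : EuclideanSpace ℝ (Fin d) →L[ℝ] EuclideanSpace ℝ (Fin d)) x,
      |inner ℝ (P x) (S x)| ≤ ‖P‖ * ‖S‖ * ‖x‖ ^ 2 := by
    intro S x
    calc |inner ℝ (P x) (S x)| ≤ ‖P x‖ * ‖S x‖ := abs_real_inner_le_norm _ _
      _ ≤ (‖P‖ * ‖x‖) * (‖S‖ * ‖x‖) := by
        gcongr
        exacts [P.le_opNorm x, S.le_opNorm x]
      _ = _ := by ring
  have hint : ∀ {Z : Ω → EuclideanSpace ℝ (Fin d)} {C : ℝ}, Measurable Z → (∀ ω, ‖Z ω‖ ≤ C) →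
      ∀ S : EuclideanSpace ℝ (Fin d) →L[ℝ] EuclideanSpace ℝ (Fin d),
        Integrable (fun ω => inner ℝ (P (Z ω)) (S (Z ω))) μ := by
    intro Z C hZ hC S
    refine Integrable.of_bound ((hquad P S).measurable.comp hZ).aestronglyMeasurable
      (‖P‖ * ‖S‖ * C ^ 2) (Eventually.of_forall fun ω => (hbound S _).trans ?_)
    gcongr
    exact hC ω
  have hnorm : Integrable (fun ω => ‖X a ω‖ ^ 2) μ := by
    refine Integrable.of_bound (by fun_prop) (K ^ 2) (Eventually.of_forall fun ω => ?_)
    rw [norm_pow, norm_norm]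
    gcongr
    exact hK ω
  -- `Y i` depends only on the past; `F i` is the centred occupation integral of the state `i`.
  set Y : Fin n → Ω → ℝ := fun i ω => inner ℝ (P (X a ω)) (L i (X a ω)) with hYdef
  set F : Fin n → Ω → ℝ := fun i ω =>
    ∫ u in (a : ℝ)..((a + h : ℝ≥0) : ℝ), (Q *ᵥ w i) (I u.toNNReal ω) with hFdef
  have hY : ∀ i, Integrable (Y i) μ := fun i => hint haΩ hK (L i)
  have hYm : ∀ i, StronglyMeasurable[𝓕 a] (Y i) := fun i =>
    ((hquad P (L i)).measurable.comp ha).stronglyMeasurable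
  have hYle : ∀ i, ∫ ω, |Y i ω| ∂μ ≤ ‖P‖ * M * ∫ ω, ‖X a ω‖ ^ 2 ∂μ := by
    intro i
    rw [← integral_const_mul]
    refine integral_mono (hY i).abs (hnorm.const_mul _) fun ω => (hbound (L i) _).trans ?_
    gcongr
    exact hM i
  have hFm : ∀ i, Measurable (F i) := by
    intro i
    have h1 : Measurable fun q : ℝ × Ω => (Q *ᵥ w i) (I q.1.toNNReal q.2) :=
      (measurable_of_countable (Q *ᵥ w i)).comp hI.measurable_uncurry
    have h2 := (measurable_setIntegral_Ioc h1 a).comp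
      (measurable_prodMk_left (x := ((a + h : ℝ≥0) : ℝ)))
    have hle : (a : ℝ) ≤ ((a + h : ℝ≥0) : ℝ) := by exact_mod_cast le_self_add
    simp_rw [hFdef, intervalIntegral.integral_of_le hle]
    exact h2
  have hFb : ∀ i ω, ‖F i ω‖ ≤ ‖Q *ᵥ w i‖ * |((a + h : ℝ≥0) : ℝ) - a| := fun i ω =>
    intervalIntegral.norm_integral_le_of_norm_le_const fun u _ => norm_le_pi_norm (Q *ᵥ w i) _
  have hYF : ∀ i, Integrable (fun ω => Y i ω * F i ω) μ := fun i =>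
    (hY i).mul_bdd (hFm i).aestronglyMeasurable (Eventually.of_forall (hFb i))
  have hstep : ∀ ω, inner ℝ (P (X (a + h) ω)) (X (a + h) ω) ≤ inner ℝ (P (X a ω)) (X a ω)
      + 2 * ∑ i, Y i ω * F i ω - (h * c - 8 * ‖P‖ * M ^ 2 * h ^ 2) * ‖X a ω‖ ^ 2 := by
    intro ω
    obtain ⟨h1, h2⟩ := (hX ω).shift a h
    have h3 := inner_le_of_integral_eq (L := L) (P := P) (p := p)
      (J := fun u : ℝ => I u.toNNReal ω) (y := fun u => X u.toNNReal ω) hPs hPc hM h.coe_nonneg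
      hMh (hI.measurable_uncurry.comp measurable_prodMk_right) h1 h2
    rw [← NNReal.coe_add, Real.toNNReal_coe, Real.toNNReal_coe] at h3
    simpa only [← hw] using h3
  have hsum : ∑ i, ∫ ω, Y i ω * F i ω ∂μ
      ≤ 2 * ‖P‖ * M * (∑ i, ‖w i‖) / r * ∫ ω, ‖X a ω‖ ^ 2 ∂μ := by
    have h1 : ∀ i ∈ Finset.univ, ∫ ω, Y i ω * F i ω ∂μ
        ≤ 2 * ‖w i‖ / r * (‖P‖ * M * ∫ ω, ‖X a ω‖ ^ 2 ∂μ) := by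
      intro i _
      refine (le_abs_self _).trans ((hI.abs_integral_mul_integral_le hr le_self_add (hYm i) (hY i)
        (w i)).trans ?_)
      gcongr
      exact hYle i
    refine (Finset.sum_le_sum h1).trans (le_of_eq ?_)
    rw [← Finset.sum_mul, ← Finset.sum_div, ← Finset.mul_sum]
    ring
  have hXq : Integrable (fun ω => inner ℝ (P (X a ω)) (X a ω)) μ :=
    hint haΩ hK (ContinuousLinearMap.id ℝ _)
  have hXq' : Integrable (fun ω => inner ℝ (P (X (a + h) ω)) (X (a + h) ω)) μ :=
    hint (C := 2 * K) hahΩ (fun ω => ((hX ω).norm_le hM hMh le_self_add le_rfl).trans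
      (mul_le_mul_of_nonneg_left (hK ω) two_pos.le)) (ContinuousLinearMap.id ℝ _)
  have hsumint : Integrable (fun ω => 2 * ∑ i, Y i ω * F i ω) μ :=
    (integrable_finsetSum _ fun i _ => hYF i).const_mul 2
  have hadd : Integrable (fun ω => inner ℝ (P (X a ω)) (X a ω) + 2 * ∑ i, Y i ω * F i ω) μ :=
    hXq.add hsumint
  have hmono := integral_mono hXq' (hadd.sub (hnorm.const_mul _)) hstep
  rw [integral_sub' hadd (hnorm.const_mul _), integral_add hXq hsumint,
    integral_const_mul, integral_const_mul, integral_finsetSum _ fun i _ => hYF i] at hmono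
  have h5 : 4 * ‖P‖ * M * (∑ i, ‖w i‖) / r = 2 * (2 * ‖P‖ * M * (∑ i, ‖w i‖) / r) := by ring
  rw [h5, sub_mul _ (2 * _), mul_assoc 2]
  linarith

/-- Almost sure stability for bounded initial conditions: the expected quadratic form decreases at
the times `k h`, so the second moments at these times are summable. -/
theorem IsMarkovChain.ae_tendsto_zero_of_bounded [IsProbabilityMeasure μ] {r : ℝ} (hr : 0 < r)
    (hI : IsMarkovChain (r • Q) μ 𝓕 I)
    (hX : ∀ ω, IsSwitchedSolution A (fun t => I t ω) (fun t => X t ω))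
    {P : EuclideanSpace ℝ (Fin d) →L[ℝ] EuclideanSpace ℝ (Fin d)} {p : Fin n → ℝ}
    {w : Fin n → Fin n → ℝ} {M c : ℝ} {h : ℝ≥0}
    (hPs : ∀ x z, inner ℝ (P x) z = inner ℝ (P z) x) (hP0 : ∀ x, 0 ≤ inner ℝ (P x) x)
    (hPc : ∀ x, 2 * inner ℝ (P x) (∑ i, p i • Matrix.toEuclideanCLM (𝕜 := ℝ) (A i) x)
      ≤ -c * ‖x‖ ^ 2)
    (hw : ∀ i, Q *ᵥ w i = Pi.single i 1 - Function.const _ (p i))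
    (hM : ∀ i, ‖Matrix.toEuclideanCLM (𝕜 := ℝ) (A i)‖ ≤ M) (hMh : M * h ≤ 1 / 2)
    (hh : 0 < h)
    (hδ : 0 < h * c - 8 * ‖P‖ * M ^ 2 * h ^ 2 - 4 * ‖P‖ * M * (∑ i, ‖w i‖) / r)
    (hX0 : Measurable[𝓕 0] (X 0)) {K : ℝ} (hK : ∀ ω, ‖X 0 ω‖ ≤ K) :
    ∀ᵐ ω ∂μ, Tendsto (fun t : ℝ≥0 => ‖X t ω‖) atTop (𝓝 0) := by
  have hτ : ∀ k : ℕ, ((k + 1 : ℕ) : ℝ≥0) * h = k * h + h := fun k => by push_cast; ring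
  have hgrid : ∀ k : ℕ, Measurable[𝓕 (k * h)] (X (k * h)) ∧ ∀ ω, ‖X (k * h) ω‖ ≤ 2 ^ k * K := by
    intro k
    induction k with
    | zero =>
      rw [Nat.cast_zero, zero_mul, pow_zero, one_mul]
      exact ⟨hX0, hK⟩
    | succ k ih =>
      rw [hτ]
      refine ⟨hI.measurable_solution hX hM hMh ih.1, fun ω => ?_⟩
      have h1 := (hX ω).norm_le hM hMh (a := k * h) (t := k * h + h) le_self_add le_rfl
      rw [pow_succ']
      linarith [ih.2 ω]
  have hsum : Summable fun k : ℕ => ∫ ω, ‖X (k * h) ω‖ ^ 2 ∂μ := by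
    refine summable_of_le_sub_mul hδ
      (q := fun k : ℕ => ∫ ω, inner ℝ (P (X (k * h) ω)) (X (k * h) ω) ∂μ)
      (fun k => integral_nonneg fun ω => hP0 _) (fun k => integral_nonneg fun ω => by positivity)
      fun k => ?_
    rw [hτ]
    exact hI.integral_inner_le hr hX hPs hPc hw hM hMh (hgrid k).1 (hgrid k).2
  have hint : ∀ k : ℕ, Integrable (fun ω => ‖X (k * h) ω‖ ^ 2) μ := by
    intro k
    have h1 : Measurable (X (k * h)) := (hgrid k).1.mono (𝓕.le _) le_rfl
    refine Integrable.of_bound (by fun_prop) ((2 ^ k * K) ^ 2) (Eventually.of_forall fun ω => ?_)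
    rw [norm_pow, norm_norm]
    have := (hgrid k).2 ω
    gcongr
  filter_upwards [ae_tendsto_zero_of_summable_integral_sq hint hsum] with ω hω
  -- Between grid points the norm at most doubles.
  have hfloor : Tendsto (fun t : ℝ≥0 => ⌊t / h⌋₊) atTop atTop :=
    tendsto_nat_floor_atTop.comp (tendsto_id.atTop_div_const hh)
  have h2 := (hω.comp hfloor).const_mul 2
  rw [mul_zero] at h2
  refine squeeze_zero (fun _ => norm_nonneg _) (fun t => ?_) h2
  have h3 : (⌊t / h⌋₊ : ℝ≥0) * h ≤ t := by
    rw [← le_div_iff₀ hh]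
    exact Nat.floor_le zero_le
  have h4 : t ≤ (⌊t / h⌋₊ : ℝ≥0) * h + h := by
    have := (Nat.lt_floor_add_one (t / h)).le
    rw [div_le_iff₀ hh] at this
    rwa [add_mul, one_mul] at this
  exact (hX ω).norm_le hM hMh h3 h4

end Bounded

theorem IsSwitchedSolution.smul {n d : ℕ} {A : Fin n → Matrix (Fin d) (Fin d) ℝ}
    {I : ℝ≥0 → Fin n} {x : ℝ≥0 → EuclideanSpace ℝ (Fin d)} (hx : IsSwitchedSolution A I x)
    (c : ℝ) : IsSwitchedSolution A I fun t => c • x t := by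
  intro t
  simp only [map_smul]
  refine ⟨⟨(hx t).1.1.smul c, (hx t).1.2.smul c⟩, ?_⟩
  rw [intervalIntegral.integral_smul, ← smul_add, ← (hx t).2]

theorem mainTheorem3 {n d : ℕ} (A : Fin n → Matrix (Fin d) (Fin d) ℝ)
    (Q : Matrix (Fin n) (Fin n) ℝ) (hQ : IsGenerator Q) (hirr : IsIrreducibleGenerator Q)
    (p : Fin n → ℝ) (hp : IsInvariantProb Q p)
    (hA : Hurwitz (∑ i, p i • A i)) :
    ∃ b : ℝ, 0 < b ∧ ∀ r : ℝ, b < r →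
      ∀ (Ω : Type u) (mΩ : MeasurableSpace Ω) (μ : Measure Ω) (_ : IsProbabilityMeasure μ)
        (𝓕 : Filtration ℝ≥0 mΩ) (I : ℝ≥0 → Ω → Fin n)
        (X : ℝ≥0 → Ω → EuclideanSpace ℝ (Fin d)),
        IsMarkovChain (r • Q) μ 𝓕 I →
        Measurable[𝓕 0] (X 0) →
        Integrable (X 0) μ →
        (∀ ω, IsSwitchedSolution A (fun t => I t ω) (fun t => X t ω)) →
        ∀ᵐ ω ∂μ, Tendsto (fun t : ℝ≥0 => ‖X t ω‖) atTop (𝓝 0) := by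
  obtain ⟨P, hPs, hPpos, c, hc, hPc⟩ := hA.exists_lyapunov
  have hPc' : ∀ x, 2 * inner ℝ (P x) (∑ i, p i • Matrix.toEuclideanCLM (𝕜 := ℝ) (A i) x)
      ≤ -c * ‖x‖ ^ 2 := by
    intro x
    have h1 : Matrix.toEuclideanCLM (𝕜 := ℝ) (∑ i, p i • A i) x
        = ∑ i, p i • Matrix.toEuclideanCLM (𝕜 := ℝ) (A i) x := by
      simp [map_sum, map_smul]
    rw [← h1]
    exact hPc x
  have hpoisson : ∀ i, ∃ w : Fin n → ℝ, Q *ᵥ w = Pi.single i 1 - Function.const _ (p i) := by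
    intro i
    refine hQ.exists_poisson hirr hp ?_
    simp [dotProduct, mul_sub, Pi.single_apply, ← Finset.sum_mul, hp.sum_eq_one]
  choose w hw using hpoisson
  set M := ∑ i, ‖Matrix.toEuclideanCLM (𝕜 := ℝ) (A i)‖ with hMdef
  have hM : ∀ i, ‖Matrix.toEuclideanCLM (𝕜 := ℝ) (A i)‖ ≤ M := fun i =>
    Finset.single_le_sum (f := fun i => ‖Matrix.toEuclideanCLM (𝕜 := ℝ) (A i)‖)
      (fun _ _ => norm_nonneg _) (Finset.mem_univ i)
  have hM0 : 0 ≤ M := Finset.sum_nonneg fun _ _ => norm_nonneg _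
  -- The step `h` is fixed first, in terms of the Lyapunov form only; the switching rate then has
  -- to be large compared with `1 / h`.
  obtain ⟨h, hh, hMh, hh2⟩ : ∃ h : ℝ, 0 < h ∧ M * h ≤ 1 / 2 ∧ 8 * ‖P‖ * M ^ 2 * h ≤ c / 2 := by
    have h1 : Tendsto (fun h : ℝ => M * h) (𝓝[>] 0) (𝓝 0) := by
      have : Continuous fun h : ℝ => M * h := by fun_prop
      simpa using (this.tendsto 0).mono_left nhdsWithin_le_nhds
    have h2 : Tendsto (fun h : ℝ => 8 * ‖P‖ * M ^ 2 * h) (𝓝[>] 0) (𝓝 0) := by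
      have : Continuous fun h : ℝ => 8 * ‖P‖ * M ^ 2 * h := by fun_prop
      simpa using (this.tendsto 0).mono_left nhdsWithin_le_nhds
    obtain ⟨h, h3, h4, h5⟩ := ((eventually_mem_nhdsWithin (s := Set.Ioi (0 : ℝ))).and
      ((h1.eventually_le_const (by norm_num : (0 : ℝ) < 1 / 2)).and
        (h2.eventually_le_const (half_pos hc)))).exists
    exact ⟨h, h3, h4, h5⟩
  lift h to ℝ≥0 using hh.le
  set S := 4 * ‖P‖ * M * ∑ i, ‖w i‖ with hS
  have hS0 : 0 ≤ S := mul_nonneg (by positivity) (Finset.sum_nonneg fun _ _ => norm_nonneg _)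
  refine ⟨2 * S / (h * c) + 1, by positivity, fun r hr Ω mΩ μ _ 𝓕 I X hI hX0 _ hX => ?_⟩
  have hr0 : 0 < r := lt_trans (by positivity) hr
  have hδ : 0 < h * c - 8 * ‖P‖ * M ^ 2 * h ^ 2 - S / r := by
    have h1 : S / r < h * c / 2 := by
      rw [div_lt_iff₀ hr0]
      have h2 : 2 * S / (h * c) < r := by linarith
      rw [div_lt_iff₀ (by positivity)] at h2
      linarith
    have h3 := mul_le_mul_of_nonneg_left hh2 hh.le
    nlinarith
  -- By linearity, multiplying by the indicator of `‖X 0‖ ≤ K` yields a solution with bounded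
  -- initial value.
  have hK : ∀ K : ℕ, ∀ᵐ ω ∂μ, Tendsto
      (fun t : ℝ≥0 => ‖{ω | ‖X 0 ω‖ ≤ K}.indicator (fun _ => (1 : ℝ)) ω • X t ω‖) atTop (𝓝 0) := by
    intro K
    refine hI.ae_tendsto_zero_of_bounded
      (X := fun t ω => {ω | ‖X 0 ω‖ ≤ K}.indicator (fun _ => (1 : ℝ)) ω • X t ω) hr0
      (fun ω => (hX ω).smul _) hPs (fun x => (sq_nonneg _).trans (hPpos x)) hPc' hw hM hMh
      (by exact_mod_cast hh) hδ ?_ (K := K) fun ω => ?_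
    · have hset : MeasurableSet[𝓕 0] {ω | ‖X 0 ω‖ ≤ K} :=
        (measurable_norm.comp hX0) measurableSet_Iic
      exact ((measurable_const (a := (1 : ℝ))).indicator hset).smul hX0
    · by_cases hω : ‖X 0 ω‖ ≤ K <;> simp [hω]
  filter_upwards [ae_all_iff.2 hK] with ω hω
  obtain ⟨K, hKω⟩ := exists_nat_ge ‖X 0 ω‖
  simpa [Set.indicator_apply, hKω] using hω K
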